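/- Let $p>3$ be a prime, $k\ge 1$, $N=p^{2k}$, and write $\mathbb{Z}_m=\mathbb{Z}/m\mathbb{Z}$ and $e(x)=e^{2\pi i x}$. Equip $L^2(\mathbb{Z}_N)$, the space of functions $\mathbb{Z}_N\to\mathbb{C}$, with the inner product $\langle\phi,\psi\rangle=\frac1N\sum_{Q\in\mathbb{Z}_N}\phi(Q)\overline{\psi(Q)}$; $\psi$ is called normalized if $\langle\psi,\psi\rangle=1$. Let $r\in\mathbb{Z}_N$ be the inverse of $2$, and let $U_N$ be the Weil representation of $SL(2,\mathbb{Z}_N)$ on $L^2(\mathbb{Z}_N)$, that is, the unique representation such that $$U_N\begin{pmatrix}1&b\\0&1\end{pmatrix}\psi(x)=e\!\left(\tfrac{rbx^2}{N}\right)\psi(x),\quad U_N\begin{pmatrix}t&0\\0&t^{-1}\end{pmatrix}\psi(x)=\psi(tx),\quad U_N\begin{pmatrix}0&1\\-1&0\end{pmatrix}\psi(x)=\frac1{\sqrt N}\sum_{y\in\mathbb{Z}_N}\psi(y)\,e\!\left(\tfrac{2rxy}{N}\right)$$ for all $b\in\mathbb{Z}_N$ and $t\in\mathbb{Z}_N^\times$.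 Let $D\in\mathbb{Z}_N$ be such that $p\nmid D$ and $D$ is a quadratic residue modulo $p$, and let $\sqrt D\in\mathbb{Z}_N$ be an element with $\sqrt D^{\,2}=D$. A Hecke eigenfunction is a nonzero joint eigenfunction of all the operators $U_N(h)$, $h\in H_D$, where $$H_D=\left\{\begin{pmatrix}a&bD\\b&a\end{pmatrix}:\ a,b\in\mathbb{Z}_N,\ a^2-Db^2=1\right\}.$$ For $x=(x_1,x_2)\in\mathbb{Z}_N^2$ let $\zeta_x=\sum_{t\in\mathbb{Z}_{p^k}}e\!\left(\frac{x_1t}{p^k}\right)\delta_{x_2+p^kt}$, where $\delta_y$ is the indicator function of $\{y\}$; the line $\mathbb{C}\zeta_x$ depends only on $x$ modulo $p^k$. For $C\in\mathbb{Z}_{p^k}$ let $V_C$ be the span of the $\zeta_x$ with $x_1^2-Dx_2^2\equiv -C\pmod{p^k}$, and let $V_\pm$ be the span of the $\zeta_x$ with $x_1\equiv\pm\sqrt D\,x_2\not\equiv0\pmod p$. **Theorem.** Let $C\in\mathbb{Z}_{p^k}$ with $p\mid C$. If $\psi$ is a normalized Hecke eigenfunction with $\psi\in V_C\cap V_+$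 or $\psi\in V_C\cap V_-$, then for every $b\in\mathbb{Z}_N$ $$|\psi(b)|=\begin{cases}\dfrac{1}{\sqrt{1-\frac1p}}&\text{if }p\nmid b,\\[2mm]0&\text{if }p\mid b.\end{cases}$$ -/

import Mathlib

namespace CatMap

open Matrix

/-! Throughout, `N = p ^ (2 * k)` with `p` prime. -/

/-- The matrix `n_b`. -/
def matN {R : Type*} [CommRing R] (b : R) : SpecialLinearGroup (Fin 2) R :=
  ⟨!![1, b; 0, 1], by simp⟩

/-- The matrix `a_t`, for a unit `t`. -/
def matA {R : Type*} [CommRing R] (t : Rˣ) : SpecialLinearGroup (Fin 2) R :=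
  ⟨!![(t : R), 0; 0, ((t⁻¹ : Rˣ) : R)], by simp⟩

/-- The matrix `ω`. -/
def matW (R : Type*) [CommRing R] : SpecialLinearGroup (Fin 2) R :=
  ⟨!![0, 1; -1, 0], by simp⟩

/-- The underlying matrix of an element of `SL(2, R)`. -/
def toMat {R : Type*} [CommRing R] (g : SpecialLinearGroup (Fin 2) R) : Matrix (Fin 2) (Fin 2) R :=
  g.1

theorem toMat_mul {R : Type*} [CommRing R] (g h : SpecialLinearGroup (Fin 2) R) :
    toMat (g * h) = toMat g * toMat h := rfl

theorem toMat_one {R : Type*} [CommRing R] :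
    toMat (1 : SpecialLinearGroup (Fin 2) R) = 1 := rfl

theorem toMat_det {R : Type*} [CommRing R] (g : SpecialLinearGroup (Fin 2) R) :
    (toMat g).det = 1 := g.2

/-- The state space `L²(ℤ_N)`, `N = p ^ (2 * k)`, as a complex vector space. -/
abbrev State (p k : ℕ) : Type := ZMod (p ^ (2 * k)) → ℂ

/-- The inner product `(1 / N) ∑ φ(Q) conj ψ(Q)` of the state space. -/
noncomputable def stateInner (p k : ℕ) [Fact p.Prime] (φ ψ : State p k) : ℂ :=
  1 / ((p ^ (2 * k) : ℕ) : ℂ) * ∑ Q, φ Q * (starRingEnd ℂ) (ψ Q)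

/-- `ψ` has `L²`-norm one. -/
def IsNormalized (p k : ℕ) [Fact p.Prime] (ψ : State p k) : Prop :=
  stateInner p k ψ ψ = 1

/-- The operator `ψ(x) ↦ e(r b x² / N) ψ(x)`, where `2 r = 1` in `ℤ_N`;
`ZMod.stdAddChar j` is `e(j / N)`. -/
noncomputable def opN (p k : ℕ) [Fact p.Prime] (b : ZMod (p ^ (2 * k))) :
    Module.End ℂ (State p k) where
  toFun ψ := fun x => ZMod.stdAddChar ((2 : ZMod (p ^ (2 * k)))⁻¹ * b * x ^ 2) * ψ x
  map_add' φ ψ := by funext x; simp [mul_add]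
  map_smul' c ψ := by funext x; simp [mul_left_comm]

/-- The operator `ψ(x) ↦ ψ(t x)`. -/
def opA (p k : ℕ) (t : (ZMod (p ^ (2 * k)))ˣ) : Module.End ℂ (State p k) where
  toFun ψ := fun x => ψ (t * x)
  map_add' _ _ := rfl
  map_smul' _ _ := rfl

/-- The Fourier transform `ψ(x) ↦ N^{-1/2} ∑_y ψ(y) e(2 r x y / N)`, where `2 r = 1` in `ℤ_N`
and `N^{1/2} = p ^ k`. -/
noncomputable def opW (p k : ℕ) [Fact p.Prime] : Module.End ℂ (State p k) where
  toFun ψ := fun x => 1 / (p : ℂ) ^ k *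
    ∑ y, ψ y * ZMod.stdAddChar (2 * (2 : ZMod (p ^ (2 * k)))⁻¹ * x * y)
  map_add' φ ψ := by funext x; simp [add_mul, Finset.sum_add_distrib, mul_add]
  map_smul' c ψ := by
    funext x
    simp only [Pi.smul_apply, smul_eq_mul, RingHom.id_apply, mul_assoc, ← Finset.mul_sum]
    ring

/-- `U` is a representation of `SL(2, ℤ_N)` on the state space which takes the prescribed values
on the generators `n_b`, `a_t`, `ω`. -/
def IsWeilRep (p k : ℕ) [Fact p.Prime]
    (U : Representation ℂ (SpecialLinearGroup (Fin 2) (ZMod (p ^ (2 * k)))) (State p k)) : Prop :=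
  (∀ b, U (matN b) = opN p k b) ∧ (∀ t, U (matA t) = opA p k t) ∧ U (matW _) = opW p k

/-- Reduction `ℤ_N → ℤ_{p^k}`. -/
def red (p k : ℕ) : ZMod (p ^ (2 * k)) →+* ZMod (p ^ k) :=
  ZMod.castHom (pow_dvd_pow p (by omega)) (ZMod (p ^ k))

/-- `ζ_x = ∑_{t ∈ ℤ_{p^k}} e(x₁ t / p^k) δ_{x₂ + p^k t}`. -/
noncomputable def zeta (p k : ℕ) [Fact p.Prime] (x : Fin 2 → ZMod (p ^ (2 * k))) : State p k :=
  ∑ t : ZMod (p ^ k), (ZMod.stdAddChar (red p k (x 0) * t) : ℂ) •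
    Pi.single (x 1 + (p : ZMod (p ^ (2 * k))) ^ k * (t.val : ZMod (p ^ (2 * k)))) (1 : ℂ)

section WeilConstruction

variable {p k : ℕ}

theorem q_sq : (p : ZMod (p ^ (2 * k))) ^ k * (p : ZMod (p ^ (2 * k))) ^ k = 0 := by
  rw [← pow_add, ← two_mul]
  exact_mod_cast ZMod.natCast_self (p ^ (2 * k))

variable [Fact p.Prime]

theorem q_mul_eq_zero (a : ZMod (p ^ (2 * k))) :
    (p : ZMod (p ^ (2 * k))) ^ k * a = 0 ↔ red p k a = 0 := by
  obtain ⟨n, rfl⟩ := ZMod.natCast_zmod_surjective a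
  have h0 : 0 < p ^ k := pow_pos (Fact.out : p.Prime).pos k
  rw [map_natCast, ZMod.natCast_eq_zero_iff, ← Nat.cast_pow, ← Nat.cast_mul,
    ZMod.natCast_eq_zero_iff, two_mul, pow_add]
  exact Nat.mul_dvd_mul_iff_left h0

theorem red_val (t : ZMod (p ^ k)) : red p k (t.val : ZMod (p ^ (2 * k))) = t := by
  rw [map_natCast, ZMod.natCast_zmod_val]

theorem char_red (a : ZMod (p ^ (2 * k))) :
    (ZMod.stdAddChar (red p k a) : ℂ) =
      ZMod.stdAddChar ((p : ZMod (p ^ (2 * k))) ^ k * a) := by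
  obtain ⟨n, rfl⟩ := ZMod.natCast_zmod_surjective a
  have h0 : (p : ℂ) ≠ 0 := by exact_mod_cast (Fact.out : p.Prime).ne_zero
  have h1 := ZMod.stdAddChar_coe (N := p ^ k) (n : ℤ)
  have h2 := ZMod.stdAddChar_coe (N := p ^ (2 * k)) ((p ^ k * n : ℕ) : ℤ)
  rw [map_natCast]
  push_cast at h1 h2
  rw [h1, h2]
  congr 1
  field_simp
  ring

theorem zeta_apply (x : Fin 2 → ZMod (p ^ (2 * k))) (t : ZMod (p ^ (2 * k))) :
    zeta p k x (x 1 + (p : ZMod (p ^ (2 * k))) ^ k * t) =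
      ZMod.stdAddChar ((p : ZMod (p ^ (2 * k))) ^ k * (x 0 * t)) := by
  rw [← char_red, map_mul, zeta, Finset.sum_apply, Finset.sum_eq_single (red p k t)]
  · have h : (p : ZMod (p ^ (2 * k))) ^ k * t =
        (p : ZMod (p ^ (2 * k))) ^ k * ((red p k t).val : ZMod (p ^ (2 * k))) := by
      rw [← sub_eq_zero, ← mul_sub, q_mul_eq_zero, map_sub, red_val, sub_self]
    rw [h]
    simp
  · intro s _ hs
    have h : x 1 + (p : ZMod (p ^ (2 * k))) ^ k * t ≠
        x 1 + (p : ZMod (p ^ (2 * k))) ^ k * (s.val : ZMod (p ^ (2 * k))) := by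
      intro h
      apply hs
      rw [add_right_inj, ← sub_eq_zero, ← mul_sub, q_mul_eq_zero, map_sub, red_val,
        sub_eq_zero] at h
      exact h.symm
    rw [Pi.smul_apply, Pi.single_eq_of_ne h, smul_zero]
  · simp

theorem zeta_apply_of_not (x : Fin 2 → ZMod (p ^ (2 * k))) (y : ZMod (p ^ (2 * k)))
    (h : ¬ ∃ t, y = x 1 + (p : ZMod (p ^ (2 * k))) ^ k * t) : zeta p k x y = 0 := by
  rw [zeta, Finset.sum_apply]
  refine Finset.sum_eq_zero fun t _ => ?_
  rw [Pi.smul_apply, Pi.single_eq_of_ne (fun e => h ⟨_, e⟩ :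
    y ≠ x 1 + (p : ZMod (p ^ (2 * k))) ^ k * (t.val : ZMod (p ^ (2 * k)))), smul_zero]

/-- `ζ_x` with the phase that makes the action of `SL(2, ℤ_N)` a permutation. -/
noncomputable def eta (x : Fin 2 → ZMod (p ^ (2 * k))) : State p k :=
  (ZMod.stdAddChar ((2 : ZMod (p ^ (2 * k)))⁻¹ * x 0 * x 1) : ℂ) • zeta p k x

theorem two_mul_inv_two (hp : p ≠ 2) : (2 : ZMod (p ^ (2 * k))) * 2⁻¹ = 1 := by
  have h : Nat.Coprime 2 (p ^ (2 * k)) :=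
    Nat.Coprime.pow_right _ ((Nat.coprime_primes Nat.prime_two Fact.out).2 (Ne.symm hp))
  exact_mod_cast ZMod.coe_mul_inv_eq_one 2 h

theorem opN_eta (hp : p ≠ 2) (b : ZMod (p ^ (2 * k))) (x : Fin 2 → ZMod (p ^ (2 * k))) :
    opN p k b (eta x) = eta (toMat (matN b) *ᵥ x) := by
  have h0 : (toMat (matN b) *ᵥ x) 0 = x 0 + b * x 1 := by simp [toMat, matN, mulVec, dotProduct]
  have h1 : (toMat (matN b) *ᵥ x) 1 = x 1 := by simp [toMat, matN, mulVec, dotProduct]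
  funext y
  simp only [opN, eta, LinearMap.coe_mk, AddHom.coe_mk, Pi.smul_apply, smul_eq_mul]
  by_cases h : ∃ t, y = x 1 + (p : ZMod (p ^ (2 * k))) ^ k * t
  · obtain ⟨t, rfl⟩ := h
    have hz := zeta_apply (toMat (matN b) *ᵥ x) t
    rw [h1] at hz
    rw [zeta_apply, hz, h0, h1]
    simp only [← AddChar.map_add_eq_mul]
    congr 1
    linear_combination (b * x 1 * ((p : ZMod (p ^ (2 * k))) ^ k * t)) * two_mul_inv_two hp +
      (2 : ZMod (p ^ (2 * k)))⁻¹ * b * t ^ 2 * (q_sq (p := p) (k := k))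
  · rw [zeta_apply_of_not x y h, zeta_apply_of_not _ y (by rwa [h1])]
    simp

theorem opA_eta (s : (ZMod (p ^ (2 * k)))ˣ) (x : Fin 2 → ZMod (p ^ (2 * k))) :
    opA p k s (eta x) = eta (toMat (matA s) *ᵥ x) := by
  have h0 : (toMat (matA s) *ᵥ x) 0 = s * x 0 := by simp [toMat, matA, mulVec, dotProduct]
  have h1 : (toMat (matA s) *ᵥ x) 1 = ((s⁻¹ : (ZMod (p ^ (2 * k)))ˣ) : ZMod (p ^ (2 * k))) * x 1 := by
    simp [toMat, matA, mulVec, dotProduct]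
  have hs := s.mul_inv
  funext y
  simp only [opA, eta, LinearMap.coe_mk, AddHom.coe_mk, Pi.smul_apply, smul_eq_mul]
  by_cases h : ∃ t, y = (toMat (matA s) *ᵥ x) 1 + (p : ZMod (p ^ (2 * k))) ^ k * t
  · obtain ⟨t, rfl⟩ := h
    have hy : (s : ZMod (p ^ (2 * k))) *
        ((toMat (matA s) *ᵥ x) 1 + (p : ZMod (p ^ (2 * k))) ^ k * t) =
        x 1 + (p : ZMod (p ^ (2 * k))) ^ k * (s * t) := by
      rw [h1]
      linear_combination x 1 * hs
    rw [zeta_apply, hy, zeta_apply, h0, h1]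
    simp only [← AddChar.map_add_eq_mul]
    congr 1
    linear_combination (-(2 : ZMod (p ^ (2 * k)))⁻¹ * x 0 * x 1) * hs
  · rw [zeta_apply_of_not _ y h, zeta_apply_of_not x]
    · simp
    · rintro ⟨t, ht⟩
      refine h ⟨((s⁻¹ : (ZMod (p ^ (2 * k)))ˣ) : ZMod (p ^ (2 * k))) * t, ?_⟩
      rw [h1]
      linear_combination ((s⁻¹ : (ZMod (p ^ (2 * k)))ˣ) : ZMod (p ^ (2 * k))) * ht - y * hs

theorem sum_char (a : ZMod (p ^ k)) :
    ∑ t : ZMod (p ^ k), (ZMod.stdAddChar (a * t) : ℂ) = if a = 0 then (p : ℂ) ^ k else 0 := by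
  have h := AddChar.sum_mulShift a (ZMod.isPrimitive_stdAddChar (p ^ k))
  simp only [ZMod.card] at h
  simp only [mul_comm a]
  rw [h]
  split_ifs <;> simp

theorem opW_zeta (hp : p ≠ 2) (x : Fin 2 → ZMod (p ^ (2 * k))) (y : ZMod (p ^ (2 * k))) :
    opW p k (zeta p k x) y =
      if red p k (x 0 + y) = 0 then (ZMod.stdAddChar (y * x 1) : ℂ) else 0 := by
  have hp0 : (p : ℂ) ≠ 0 := by exact_mod_cast (Fact.out : p.Prime).ne_zero
  have key : ∑ z, zeta p k x z * (ZMod.stdAddChar (y * z) : ℂ) =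
      ZMod.stdAddChar (y * x 1) *
        ∑ t : ZMod (p ^ k), (ZMod.stdAddChar (red p k (x 0 + y) * t) : ℂ) := by
    simp only [zeta, Finset.sum_apply, Finset.sum_mul, Pi.smul_apply, smul_eq_mul]
    rw [Finset.sum_comm, Finset.mul_sum]
    refine Finset.sum_congr rfl fun t _ => ?_
    rw [Finset.sum_eq_single
      (x 1 + (p : ZMod (p ^ (2 * k))) ^ k * (t.val : ZMod (p ^ (2 * k))))]
    · rw [Pi.single_eq_same, mul_one]
      nth_rewrite 1 [← red_val t]
      nth_rewrite 3 [← red_val t]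
      rw [← map_mul, ← map_mul, char_red, char_red]
      simp only [← AddChar.map_add_eq_mul]
      congr 1
      ring
    · intro z _ hz
      rw [Pi.single_eq_of_ne hz, mul_zero, zero_mul]
    · simp
  simp only [opW, LinearMap.coe_mk, AddHom.coe_mk, two_mul_inv_two hp, one_mul]
  rw [key, sum_char]
  split_ifs
  · field_simp
  · simp

theorem opW_eta (hp : p ≠ 2) (x : Fin 2 → ZMod (p ^ (2 * k))) :
    opW p k (eta x) = eta (toMat (matW _) *ᵥ x) := by
  have h0 : (toMat (matW (ZMod (p ^ (2 * k)))) *ᵥ x) 0 = x 1 := by simp [toMat, matW, mulVec, dotProduct]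
  have h1 : (toMat (matW (ZMod (p ^ (2 * k)))) *ᵥ x) 1 = - x 0 := by simp [toMat, matW, mulVec, dotProduct]
  funext y
  simp only [eta, map_smul, Pi.smul_apply, smul_eq_mul]
  rw [opW_zeta hp]
  by_cases h : ∃ t, y = (toMat (matW (ZMod (p ^ (2 * k)))) *ᵥ x) 1 + (p : ZMod (p ^ (2 * k))) ^ k * t
  · obtain ⟨t, rfl⟩ := h
    rw [zeta_apply, h0, h1, if_pos]
    · simp only [← AddChar.map_add_eq_mul]
      congr 1
      linear_combination x 0 * x 1 * two_mul_inv_two (k := k) hp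
    · rw [← q_mul_eq_zero]
      linear_combination t * (q_sq (p := p) (k := k))
  · rw [zeta_apply_of_not _ y h, if_neg]
    · simp
    · intro hr
      apply h
      have hv : ((x 0 + y).val : ZMod (p ^ (2 * k))) = x 0 + y := ZMod.natCast_zmod_val _
      rw [← hv, map_natCast, ZMod.natCast_eq_zero_iff] at hr
      obtain ⟨m, hm⟩ := hr
      refine ⟨m, ?_⟩
      rw [hm] at hv
      push_cast at hv
      rw [h1, hv]
      ring

theorem end_ext {S T : Module.End ℂ (State p k)} (h : ∀ x, S (eta x) = T (eta x)) : S = T := by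
  have hp0 : (p : ℂ) ^ k ≠ 0 := pow_ne_zero _ (by exact_mod_cast (Fact.out : p.Prime).ne_zero)
  have hz : ∀ x, S (zeta p k x) = T (zeta p k x) := by
    intro x
    have h1 := h x
    simp only [eta, map_smul] at h1
    have hne : (ZMod.stdAddChar ((2 : ZMod (p ^ (2 * k)))⁻¹ * x 0 * x 1) : ℂ) ≠ 0 := by
      intro h0
      have h2 := AddChar.map_add_eq_mul (ZMod.stdAddChar (N := p ^ (2 * k)))
        ((2 : ZMod (p ^ (2 * k)))⁻¹ * x 0 * x 1) (-((2 : ZMod (p ^ (2 * k)))⁻¹ * x 0 * x 1))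
      rw [h0] at h2
      simp at h2
    exact smul_right_injective _ hne h1
  have hs : ∀ y : ZMod (p ^ (2 * k)),
      ∑ j : ZMod (p ^ k), zeta p k ![(j.val : ZMod (p ^ (2 * k))), y] =
        (p : ℂ) ^ k • (Pi.single y (1 : ℂ) : State p k) := by
    intro y
    funext z
    rw [Finset.sum_apply]
    by_cases hzy : ∃ t, z = y + (p : ZMod (p ^ (2 * k))) ^ k * t
    · obtain ⟨t, rfl⟩ := hzy
      have e1 : ∀ j : ZMod (p ^ k), zeta p k ![(j.val : ZMod (p ^ (2 * k))), y]
          (y + (p : ZMod (p ^ (2 * k))) ^ k * t) = ZMod.stdAddChar (red p k t * j) := by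
        intro j
        have := zeta_apply ![(j.val : ZMod (p ^ (2 * k))), y] t
        simp only [cons_val_zero, cons_val_one] at this
        rw [this, ← char_red, map_mul, red_val, mul_comm]
      simp only [e1]
      rw [sum_char, Pi.smul_apply, Pi.single_apply]
      simp [q_mul_eq_zero]
    · rw [Finset.sum_eq_zero fun j _ => zeta_apply_of_not _ z (by simpa using hzy)]
      rw [Pi.smul_apply, Pi.single_eq_of_ne, smul_zero]
      rintro rfl
      exact hzy ⟨0, by simp⟩
  refine LinearMap.pi_ext' fun y => LinearMap.ext_ring ?_
  have h3 : S (∑ j : ZMod (p ^ k), zeta p k ![(j.val : ZMod (p ^ (2 * k))), y]) =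
      T (∑ j : ZMod (p ^ k), zeta p k ![(j.val : ZMod (p ^ (2 * k))), y]) := by
    simp only [map_sum, hz]
  rw [hs, map_smul, map_smul] at h3
  exact smul_right_injective _ hp0 h3

theorem isUnit_or (a b c d : ZMod (p ^ (2 * k))) (h : a * d - b * c = 1) :
    IsUnit a ∨ IsUnit c := by
  by_contra hcon
  rw [not_or] at hcon
  obtain ⟨m, rfl⟩ := ZMod.natCast_zmod_surjective a
  obtain ⟨n, rfl⟩ := ZMod.natCast_zmod_surjective c
  have hpp : p.Prime := Fact.out
  have hdiv : ∀ n : ℕ, ¬ IsUnit (n : ZMod (p ^ (2 * k))) →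
      (p : ZMod (p ^ (2 * k))) ∣ n ∧ 0 < 2 * k := by
    intro n hn
    rw [ZMod.isUnit_iff_coprime] at hn
    have hk : 0 < 2 * k := by
      rcases Nat.eq_zero_or_pos (2 * k) with h | h
      · rw [h] at hn; simp at hn
      · exact h
    rw [Nat.coprime_pow_right_iff hk, Nat.coprime_comm, hpp.coprime_iff_not_dvd, not_not] at hn
    exact ⟨by exact_mod_cast Nat.cast_dvd_cast hn, hk⟩
  obtain ⟨h1, hk⟩ := hdiv m hcon.1
  obtain ⟨h2, -⟩ := hdiv n hcon.2
  have h3 : (p : ZMod (p ^ (2 * k))) ∣ 1 := by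
    rw [← h]
    exact dvd_sub (h1.mul_right _) (h2.mul_left _)
  have h4 : IsUnit (p : ZMod (p ^ (2 * k))) := isUnit_of_dvd_one h3
  rw [ZMod.isUnit_iff_coprime, Nat.coprime_pow_right_iff hk, Nat.coprime_self] at h4
  exact hpp.one_lt.ne' h4

/-- Induction along the generators `n_b`, `a_t`, `ω`. -/
theorem sl_induction {P : SpecialLinearGroup (Fin 2) (ZMod (p ^ (2 * k))) → Prop}
    (hn : ∀ b, P (matN b)) (ha : ∀ t, P (matA t)) (hw : P (matW _))
    (hm : ∀ g h, P g → P h → P (g * h)) (g) : P g := by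
  have main : ∀ g : SpecialLinearGroup (Fin 2) (ZMod (p ^ (2 * k))), IsUnit (toMat g 1 0) → P g := by
    rintro g ⟨u, hu⟩
    have hdet := toMat_det g
    rw [det_fin_two] at hdet
    have hg : g = matN (toMat g 0 0 * ((u⁻¹ : (ZMod (p ^ (2 * k)))ˣ) : ZMod (p ^ (2 * k)))) *
        (matW _ * (matN (toMat g 1 0 * toMat g 1 1) * matA (-u))) := by
      have hi := u.mul_inv
      rw [hu] at hi
      apply Subtype.ext
      change toMat g = toMat _
      simp only [toMat_mul]
      rw [show toMat (matN (toMat g 0 0 * ((u⁻¹ : (ZMod (p ^ (2 * k)))ˣ) : ZMod (p ^ (2 * k))))) =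
          !![1, toMat g 0 0 * ((u⁻¹ : (ZMod (p ^ (2 * k)))ˣ) : ZMod (p ^ (2 * k))); 0, 1] from rfl,
        show toMat (matW (ZMod (p ^ (2 * k)))) = !![0, 1; -1, 0] from rfl,
        show toMat (matN (toMat g 1 0 * toMat g 1 1)) =
          !![1, toMat g 1 0 * toMat g 1 1; 0, 1] from rfl,
        show toMat (matA (-u)) = !![((-u : (ZMod (p ^ (2 * k)))ˣ) : ZMod (p ^ (2 * k))), 0;
          0, (((-u)⁻¹ : (ZMod (p ^ (2 * k)))ˣ) : ZMod (p ^ (2 * k)))] from rfl]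
      ext i j
      fin_cases i <;> fin_cases j <;> simp [hu]
      · linear_combination (-toMat g 0 0) * hi
      · linear_combination (-toMat g 0 1) * hi +
          (-((u⁻¹ : (ZMod (p ^ (2 * k)))ˣ) : ZMod (p ^ (2 * k)))) * hdet +
          (-((u⁻¹ : (ZMod (p ^ (2 * k)))ˣ) : ZMod (p ^ (2 * k))) * toMat g 0 0 * toMat g 1 1) * hi
      · linear_combination (-toMat g 1 1) * hi
    rw [hg]
    exact hm _ _ (hn _) (hm _ _ hw (hm _ _ (hn _) (ha _)))
  have hdet := toMat_det g
  rw [det_fin_two] at hdet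
  rcases isUnit_or _ _ _ _ hdet with h | h
  · have h1 : P (matW _ * g) := by
      apply main
      have : toMat (matW (ZMod (p ^ (2 * k))) * g) 1 0 = - toMat g 0 0 := by
        rw [toMat_mul, show toMat (matW (ZMod (p ^ (2 * k)))) = !![0, 1; -1, 0] from rfl]
        simp [mul_apply, Fin.sum_univ_two]
      rw [this]
      exact h.neg
    have h2 : g = matW _ * (matW _ * (matW _ * (matW _ * g))) := by
      apply Subtype.ext
      change toMat g = toMat _
      simp only [toMat_mul]
      rw [show toMat (matW (ZMod (p ^ (2 * k)))) = !![0, 1; -1, 0] from rfl]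
      ext i j
      fin_cases i <;> fin_cases j <;> simp [vecMul, dotProduct]
    rw [h2]
    exact hm _ _ hw (hm _ _ hw (hm _ _ hw h1))
  · exact main g h

theorem exists_op (hp : p ≠ 2) (g : SpecialLinearGroup (Fin 2) (ZMod (p ^ (2 * k)))) :
    ∃ T : Module.End ℂ (State p k), ∀ x, T (eta x) = eta (toMat g *ᵥ x) := by
  induction g using sl_induction with
  | hn b => exact ⟨_, opN_eta hp b⟩
  | ha t => exact ⟨_, opA_eta t⟩
  | hw => exact ⟨_, opW_eta hp⟩
  | hm g h hg hh =>
    obtain ⟨S, hS⟩ := hg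
    obtain ⟨T, hT⟩ := hh
    refine ⟨S * T, fun x => ?_⟩
    rw [Module.End.mul_apply, hT, hS, toMat_mul, mulVec_mulVec]

/-- For odd `p` there is exactly one representation with the prescribed values on generators. -/
theorem existsUnique_weilRep (p k : ℕ) [Fact p.Prime] (hp : p ≠ 2) : ∃! U, IsWeilRep p k U := by
  choose T hT using exists_op (p := p) (k := k) hp
  refine ⟨⟨⟨T, ?_⟩, ?_⟩, ⟨?_, ?_, ?_⟩, ?_⟩
  · exact end_ext fun x => by rw [hT, toMat_one]; simp
  · intro g h
    exact end_ext fun x => by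
      simp only [Module.End.mul_apply, hT, toMat_mul, mulVec_mulVec]
  · exact fun b => end_ext fun x => (hT _ x).trans (opN_eta hp b x).symm
  · exact fun t => end_ext fun x => (hT _ x).trans (opA_eta t x).symm
  · exact end_ext fun x => (hT _ x).trans (opW_eta hp x).symm
  · rintro V ⟨h1, h2, h3⟩
    refine MonoidHom.ext fun g => ?_
    change V g = T g
    induction g using sl_induction with
    | hn b => rw [h1]; exact end_ext fun x => ((hT _ x).trans (opN_eta hp b x).symm).symm
    | ha t => rw [h2]; exact end_ext fun x => ((hT _ x).trans (opA_eta t x).symm).symm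
    | hw => rw [h3]; exact end_ext fun x => ((hT _ x).trans (opW_eta hp x).symm).symm
    | hm g h hg hh =>
      rw [map_mul, hg, hh]
      exact end_ext fun x => by
        simp only [Module.End.mul_apply, hT, toMat_mul, mulVec_mulVec]

end WeilConstruction

/-- The Weil representation `U_N` of `SL(2, ℤ_N)` on the state space: the unique representation
with the prescribed values on `n_b`, `a_t`, `ω`. -/
noncomputable def weilRep (p k : ℕ) [Fact p.Prime] (hp : p ≠ 2) :
    Representation ℂ (SpecialLinearGroup (Fin 2) (ZMod (p ^ (2 * k)))) (State p k) :=
  (existsUnique_weilRep p k hp).choose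

theorem isWeilRep_weilRep (p k : ℕ) [Fact p.Prime] (hp : p ≠ 2) :
    IsWeilRep p k (weilRep p k hp) :=
  (existsUnique_weilRep p k hp).choose_spec.1

/-- The set `H_D` of matrices `(a, bD; b, a)` over `ℤ_N` with `a² - D b² = 1`. -/
def heckeSet (p k : ℕ) (D : ZMod (p ^ (2 * k))) :
    Set (SpecialLinearGroup (Fin 2) (ZMod (p ^ (2 * k)))) :=
  {h | ∃ a b : ZMod (p ^ (2 * k)), a ^ 2 - D * b ^ 2 = 1 ∧ toMat h = !![a, b * D; b, a]}

/-- `ψ` is a Hecke eigenfunction: a nonzero joint eigenfunction of all the Hecke operators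
`U_N(h)`, `h ∈ H_D`. -/
def IsHeckeEigenfunction (p k : ℕ) [Fact p.Prime] (hp : p ≠ 2) (D : ZMod (p ^ (2 * k)))
    (ψ : State p k) : Prop :=
  ψ ≠ 0 ∧ ∀ h ∈ heckeSet p k D, ∃ μ : ℂ, weilRep p k hp h ψ = μ • ψ

/-- The space `V_C`, spanned by the `ζ_x` with `x₁² - D x₂² = -C` in `ℤ_{p^k}`. The line through
`ζ_x` depends only on `x` modulo `p^k`, so `x` may range over `ℤ_N²`. -/
noncomputable def spaceV (p k : ℕ) [Fact p.Prime] (D : ZMod (p ^ (2 * k))) (C : ZMod (p ^ k)) :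
    Submodule ℂ (State p k) :=
  Submodule.span ℂ (zeta p k '' {x | red p k (x 0) ^ 2 - red p k D * red p k (x 1) ^ 2 = -C})

/-- The space spanned by the `ζ_x` with `x₁ ≡ s x₂ ≢ 0` modulo `p`. For `s ^ 2 = D` this is `V_+`
with `√D = s`, and `V_-` is obtained from `-s`. -/
noncomputable def spaceVPlus (p k : ℕ) [Fact p.Prime] (s : ZMod (p ^ (2 * k))) :
    Submodule ℂ (State p k) :=
  Submodule.span ℂ (zeta p k '' {x | (p : ZMod (p ^ (2 * k))) ∣ x 0 - s * x 1 ∧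
    ¬ (p : ZMod (p ^ (2 * k))) ∣ s * x 1})

/-- `V_-`: the sign in front of `√D` is changed. -/
noncomputable def spaceVMinus (p k : ℕ) [Fact p.Prime] (s : ZMod (p ^ (2 * k))) :
    Submodule ℂ (State p k) :=
  spaceVPlus p k (-s)

end CatMap

namespace CatMap

open Matrix

variable {p k : ℕ} [Fact p.Prime]

/-! Up to phases, `U_N(g)` permutes the states `ζ_x`: with the phase built into `eta`, it sends `eta
x` to `eta (g x)` (`weilRep_eta`). Since `U_N` is unitary, its eigenvalues have modulus one, so an
eigenfunction `ψ` of `U_N(g)` satisfies `|⟨ψ, ζ_{gx}⟩| = |⟨ψ, ζ_x⟩|`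
(`norm_stateInner_zeta_mulVec`).

The `ζ_x` with different `x` modulo `p^k` are orthogonal, and those with a fixed second coordinate
`b` sum to `p^k δ_b`. Hence `ψ(b)` is a sum of coefficients of `ψ`. For a unit `b`, the conditions
`a² - D b² ≡ -C` modulo `p^k` and `a ≡ s b` modulo `p` determine `a` modulo `p^k`, because two
solutions have unit sum. So a single coefficient survives: `ψ(b) = p^k ⟨ψ, ζ_{(a,b)}⟩`
(`apply_eq_of_mem`).

In the coordinates `x₁ ± s x₂` the group `H_D` is the diagonal torus `(l, l⁻¹)`. On the points
above, `x₁ + s x₂` is a unit, and so `H_D` is transitive on them (`exists_heckeSet_mulVec`).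
Therefore `|ψ|` is constant on units. Off the units `ψ` vanishes by its support, and normalization
over `N (1 - 1/p)` units gives the constant. -/

/-! ### Action on the `ζ_x` and unitarity -/

theorem weilRep_eta (hp : p ≠ 2) (g : SpecialLinearGroup (Fin 2) (ZMod (p ^ (2 * k))))
    (x : Fin 2 → ZMod (p ^ (2 * k))) :
    weilRep p k hp g (eta x) = eta (toMat g *ᵥ x) := by
  obtain ⟨h1, h2, h3⟩ := isWeilRep_weilRep p k hp
  induction g using sl_induction generalizing x with
  | hn b => rw [h1, opN_eta hp]
  | ha t => rw [h2, opA_eta]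
  | hw => rw [h3, opW_eta hp]
  | hm g h hg hh => rw [map_mul, Module.End.mul_apply, hh, hg, toMat_mul, mulVec_mulVec]

theorem stateInner_opN (b : ZMod (p ^ (2 * k))) (φ ψ : State p k) :
    stateInner p k (opN p k b φ) (opN p k b ψ) = stateInner p k φ ψ := by
  unfold stateInner
  congr 1
  refine Finset.sum_congr rfl fun x _ => ?_
  simp only [opN, LinearMap.coe_mk, AddHom.coe_mk, map_mul]
  have h : (ZMod.stdAddChar ((2 : ZMod (p ^ (2 * k)))⁻¹ * b * x ^ 2) : ℂ) *
      (starRingEnd ℂ) (ZMod.stdAddChar ((2 : ZMod (p ^ (2 * k)))⁻¹ * b * x ^ 2)) = 1 := by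
    rw [← AddChar.map_neg_eq_conj, ← AddChar.map_add_eq_mul, add_neg_cancel,
      AddChar.map_zero_eq_one]
  linear_combination φ x * (starRingEnd ℂ) (ψ x) * h

theorem stateInner_opA (t : (ZMod (p ^ (2 * k)))ˣ) (φ ψ : State p k) :
    stateInner p k (opA p k t φ) (opA p k t ψ) = stateInner p k φ ψ := by
  unfold stateInner
  congr 1
  exact Equiv.sum_comp t.mulLeft fun x => φ x * (starRingEnd ℂ) (ψ x)

theorem stateInner_opW (hp : p ≠ 2) (φ ψ : State p k) :
    stateInner p k (opW p k φ) (opW p k ψ) = stateInner p k φ ψ := by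
  have hp0 : (p : ℂ) ≠ 0 := by exact_mod_cast (Fact.out : p.Prime).ne_zero
  -- Orthogonality of the additive characters; the rest of the proof is Plancherel's formula.
  have horth : ∀ y z : ZMod (p ^ (2 * k)),
      ∑ x, (ZMod.stdAddChar (x * y) : ℂ) * (starRingEnd ℂ) (ZMod.stdAddChar (x * z)) =
        if y = z then (p : ℂ) ^ (2 * k) else 0 := by
    intro y z
    have h := AddChar.sum_mulShift (y - z) (ZMod.isPrimitive_stdAddChar (p ^ (2 * k)))
    simp only [ZMod.card, sub_eq_zero] at h
    calc _ = ∑ x : ZMod (p ^ (2 * k)), (ZMod.stdAddChar (x * (y - z)) : ℂ) := by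
          refine Finset.sum_congr rfl fun x _ => ?_
          rw [← AddChar.map_neg_eq_conj, ← AddChar.map_add_eq_mul, mul_sub, sub_eq_add_neg]
      _ = _ := by rw [h]; split_ifs <;> simp
  unfold stateInner
  congr 1
  simp only [opW, LinearMap.coe_mk, AddHom.coe_mk, two_mul_inv_two hp, one_mul]
  calc _ = ∑ x, ∑ y, ∑ z, (1 / (p : ℂ) ^ k * (1 / (p : ℂ) ^ k)) *
        (φ y * (starRingEnd ℂ) (ψ z) * ((ZMod.stdAddChar (x * y) : ℂ) *
          (starRingEnd ℂ) (ZMod.stdAddChar (x * z)))) := by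
        refine Finset.sum_congr rfl fun x _ => ?_
        simp only [map_mul, map_sum, map_div₀, map_one, map_pow, Complex.conj_natCast]
        rw [mul_mul_mul_comm, Finset.sum_mul_sum, Finset.mul_sum]
        refine Finset.sum_congr rfl fun y _ => ?_
        rw [Finset.mul_sum]
        refine Finset.sum_congr rfl fun z _ => ?_
        ring
    _ = ∑ y, ∑ z, (1 / (p : ℂ) ^ k * (1 / (p : ℂ) ^ k)) *
        (φ y * (starRingEnd ℂ) (ψ z) * if y = z then (p : ℂ) ^ (2 * k) else 0) := by
        rw [Finset.sum_comm]
        refine Finset.sum_congr rfl fun y _ => ?_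
        rw [Finset.sum_comm]
        refine Finset.sum_congr rfl fun z _ => ?_
        rw [← Finset.mul_sum, ← Finset.mul_sum, horth]
    _ = _ := by
        refine Finset.sum_congr rfl fun y _ => ?_
        rw [Finset.sum_eq_single y]
        · rw [if_pos rfl, two_mul, pow_add]
          field_simp
        · intro z _ hz
          rw [if_neg (Ne.symm hz)]
          simp
        · simp

/-- The Weil representation is unitary. -/
theorem stateInner_weilRep (hp : p ≠ 2) (g : SpecialLinearGroup (Fin 2) (ZMod (p ^ (2 * k))))
    (φ ψ : State p k) :
    stateInner p k (weilRep p k hp g φ) (weilRep p k hp g ψ) = stateInner p k φ ψ := by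
  obtain ⟨h1, h2, h3⟩ := isWeilRep_weilRep p k hp
  induction g using sl_induction generalizing φ ψ with
  | hn b => rw [h1, stateInner_opN]
  | ha t => rw [h2, stateInner_opA]
  | hw => rw [h3, stateInner_opW hp]
  | hm g h hg hh => rw [map_mul, Module.End.mul_apply, Module.End.mul_apply, hg, hh]

theorem stateInner_smul_left (c : ℂ) (φ ψ : State p k) :
    stateInner p k (c • φ) ψ = c * stateInner p k φ ψ := by
  simp only [stateInner, Pi.smul_apply, smul_eq_mul, Finset.mul_sum]
  exact Finset.sum_congr rfl fun _ _ => by ring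

theorem stateInner_smul_right (c : ℂ) (φ ψ : State p k) :
    stateInner p k φ (c • ψ) = (starRingEnd ℂ) c * stateInner p k φ ψ := by
  simp only [stateInner, Pi.smul_apply, smul_eq_mul, Finset.mul_sum, map_mul]
  exact Finset.sum_congr rfl fun _ _ => by ring

theorem stateInner_add_left (φ χ ψ : State p k) :
    stateInner p k (φ + χ) ψ = stateInner p k φ ψ + stateInner p k χ ψ := by
  simp only [stateInner, Pi.add_apply, add_mul, Finset.sum_add_distrib, mul_add]

theorem stateInner_sum_right {ι : Type*} (s : Finset ι) (φ : State p k) (χ : ι → State p k) :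
    stateInner p k φ (∑ i ∈ s, χ i) = ∑ i ∈ s, stateInner p k φ (χ i) := by
  simp only [stateInner, Finset.sum_apply, map_sum, Finset.mul_sum]
  exact Finset.sum_comm

theorem norm_stateInner_eta (φ : State p k) (x : Fin 2 → ZMod (p ^ (2 * k))) :
    ‖stateInner p k φ (eta x)‖ = ‖stateInner p k φ (zeta p k x)‖ := by
  rw [eta, stateInner_smul_right, norm_mul, RCLike.norm_conj, AddChar.norm_apply, one_mul]

/-- The modulus of the coefficient of an eigenfunction of `g` is invariant under `g`. -/
theorem norm_stateInner_zeta_mulVec (hp : p ≠ 2)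
    (g : SpecialLinearGroup (Fin 2) (ZMod (p ^ (2 * k)))) {ψ : State p k} {μ : ℂ}
    (hψ : weilRep p k hp g ψ = μ • ψ) (hnorm : IsNormalized p k ψ)
    (x : Fin 2 → ZMod (p ^ (2 * k))) :
    ‖stateInner p k ψ (zeta p k (toMat g *ᵥ x))‖ = ‖stateInner p k ψ (zeta p k x)‖ := by
  -- Unitarity applied to `ψ` itself gives `|μ|² ⟨ψ, ψ⟩ = ⟨ψ, ψ⟩`, and `⟨ψ, ψ⟩ = 1`.
  have hμ : ‖μ‖ = 1 := by
    have h := stateInner_weilRep hp g ψ ψ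
    rw [hψ, stateInner_smul_left, stateInner_smul_right, hnorm, mul_one, Complex.mul_conj,
      Complex.normSq_eq_norm_sq] at h
    have h' : ‖μ‖ ^ 2 = 1 := by exact_mod_cast h
    nlinarith [norm_nonneg μ]
  have h := stateInner_weilRep hp g ψ (eta x)
  rw [hψ, weilRep_eta, stateInner_smul_left] at h
  have h' := congrArg norm h
  rwa [norm_mul, hμ, one_mul, norm_stateInner_eta, norm_stateInner_eta] at h'

/-! ### Coefficients along the `ζ_x` -/

theorem stateInner_zeta (φ : State p k) (x : Fin 2 → ZMod (p ^ (2 * k))) :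
    stateInner p k φ (zeta p k x) = 1 / ((p ^ (2 * k) : ℕ) : ℂ) * ∑ t : ZMod (p ^ k),
      φ (x 1 + (p : ZMod (p ^ (2 * k))) ^ k * (t.val : ZMod (p ^ (2 * k)))) *
        ZMod.stdAddChar (-red p k (x 0) * t) := by
  simp only [stateInner, zeta, Finset.sum_apply, map_sum, Finset.mul_sum]
  rw [Finset.sum_comm]
  refine Finset.sum_congr rfl fun t _ => ?_
  rw [Finset.sum_eq_single
    (x 1 + (p : ZMod (p ^ (2 * k))) ^ k * (t.val : ZMod (p ^ (2 * k))))]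
  · simp only [Pi.smul_apply, Pi.single_eq_same, smul_eq_mul, mul_one]
    rw [← AddChar.map_neg_eq_conj, neg_mul]
  · intro z _ hz
    rw [Pi.smul_apply, Pi.single_eq_of_ne hz]
    simp
  · simp

/-- If the second coordinates differ modulo `p^k`, the supports are disjoint. Otherwise the supports
agree, and the inner product is a full sum of a nontrivial character of `ℤ_{p^k}`. -/
theorem stateInner_zeta_zeta (x y : Fin 2 → ZMod (p ^ (2 * k)))
    (h : red p k (x 0) ≠ red p k (y 0) ∨ red p k (x 1) ≠ red p k (y 1)) :
    stateInner p k (zeta p k x) (zeta p k y) = 0 := by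
  rw [stateInner_zeta]
  by_cases hf : ∃ t, y 1 = x 1 + (p : ZMod (p ^ (2 * k))) ^ k * t
  · obtain ⟨u, hu⟩ := hf
    have hx : red p k (x 0) - red p k (y 0) ≠ 0 := by
      rw [sub_ne_zero]
      refine h.resolve_right fun h1 => h1 ?_
      have hq : red p k ((p : ZMod (p ^ (2 * k))) ^ k * 1) = 0 := by
        rw [← q_mul_eq_zero]
        linear_combination (q_sq (p := p) (k := k))
      rw [mul_one] at hq
      rw [hu, map_add, map_mul, hq, zero_mul, add_zero]
    have h1 := sum_char (p := p) (k := k) (red p k (x 0) - red p k (y 0))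
    rw [if_neg hx] at h1
    rw [mul_eq_zero]
    right
    calc _ = ∑ t : ZMod (p ^ k), (ZMod.stdAddChar (red p k (x 0 * u)) : ℂ) *
          ZMod.stdAddChar ((red p k (x 0) - red p k (y 0)) * t) := by
          refine Finset.sum_congr rfl fun t _ => ?_
          rw [hu, add_assoc, ← mul_add, zeta_apply, ← char_red]
          simp only [map_mul, map_add, red_val, ← AddChar.map_add_eq_mul]
          congr 1
          ring
      _ = 0 := by rw [← Finset.mul_sum, h1, mul_zero]
  · rw [Finset.sum_eq_zero, mul_zero]
    intro t _
    rw [zeta_apply_of_not, zero_mul]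
    rintro ⟨u, hu⟩
    exact hf ⟨u - t.val, by linear_combination hu⟩

/-- The average of the `ζ_x` over the first coordinate is a point mass. -/
theorem sum_zeta (y : ZMod (p ^ (2 * k))) :
    ∑ j : ZMod (p ^ k), zeta p k ![(j.val : ZMod (p ^ (2 * k))), y] =
      (p : ℂ) ^ k • (Pi.single y (1 : ℂ) : State p k) := by
  funext z
  rw [Finset.sum_apply]
  by_cases hzy : ∃ t, z = y + (p : ZMod (p ^ (2 * k))) ^ k * t
  · obtain ⟨t, rfl⟩ := hzy
    have e1 : ∀ j : ZMod (p ^ k), zeta p k ![(j.val : ZMod (p ^ (2 * k))), y]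
        (y + (p : ZMod (p ^ (2 * k))) ^ k * t) = ZMod.stdAddChar (red p k t * j) := by
      intro j
      have := zeta_apply ![(j.val : ZMod (p ^ (2 * k))), y] t
      simp only [cons_val_zero, cons_val_one] at this
      rw [this, ← char_red, map_mul, red_val, mul_comm]
    simp only [e1]
    rw [sum_char, Pi.smul_apply, Pi.single_apply]
    simp [q_mul_eq_zero]
  · rw [Finset.sum_eq_zero fun j _ => zeta_apply_of_not _ z (by simpa using hzy)]
    rw [Pi.smul_apply, Pi.single_eq_of_ne, smul_zero]
    rintro rfl
    exact hzy ⟨0, by simp⟩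

theorem stateInner_single (φ : State p k) (y : ZMod (p ^ (2 * k))) :
    stateInner p k φ (Pi.single y (1 : ℂ)) = 1 / ((p ^ (2 * k) : ℕ) : ℂ) * φ y := by
  rw [stateInner, Finset.sum_eq_single y]
  · simp
  · intro z _ hz
    simp [hz]
  · simp

/-- A state orthogonal to all `ζ_z` over `x₂` except `ζ_x` has its value at `x₂` given by its
coefficient along `ζ_x`. -/
theorem apply_eq_stateInner_zeta (φ : State p k) (x : Fin 2 → ZMod (p ^ (2 * k)))
    (h : ∀ w, red p k w ≠ red p k (x 0) → stateInner p k φ (zeta p k ![w, x 1]) = 0) :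
    φ (x 1) = (p : ℂ) ^ k * stateInner p k φ (zeta p k x) := by
  have hp0 : (p : ℂ) ≠ 0 := by exact_mod_cast (Fact.out : p.Prime).ne_zero
  have h1 := congrArg (stateInner p k φ) (sum_zeta (p := p) (k := k) (x 1))
  rw [stateInner_sum_right, stateInner_smul_right, stateInner_single,
    Finset.sum_eq_single (red p k (x 0))] at h1
  -- `ζ_x` depends on its first coordinate only modulo `p^k`, so the chosen lift of that class is
  -- harmless.
  · have h2 : stateInner p k φ (zeta p k ![((red p k (x 0)).val : ZMod (p ^ (2 * k))), x 1]) =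
        stateInner p k φ (zeta p k x) := by
      rw [stateInner_zeta, stateInner_zeta]
      simp
    rw [h2] at h1
    rw [h1]
    push_cast
    simp only [map_pow, Complex.conj_natCast]
    rw [two_mul, pow_add]
    field_simp
  · intro j _ hj
    exact h _ (by rwa [red_val])
  · simp

theorem stateInner_eq_zero_of_mem_span {S : Set (Fin 2 → ZMod (p ^ (2 * k)))} {φ : State p k}
    (hφ : φ ∈ Submodule.span ℂ (zeta p k '' S)) (y : Fin 2 → ZMod (p ^ (2 * k)))
    (h : ∀ x ∈ S, red p k (x 0) ≠ red p k (y 0) ∨ red p k (x 1) ≠ red p k (y 1)) :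
    stateInner p k φ (zeta p k y) = 0 := by
  induction hφ using Submodule.span_induction with
  | mem φ hm =>
    obtain ⟨x, hx, rfl⟩ := hm
    exact stateInner_zeta_zeta x y (h x hx)
  | zero => simp [stateInner]
  | add φ χ _ _ h1 h2 => rw [stateInner_add_left, h1, h2, add_zero]
  | smul c φ _ h1 => rw [stateInner_smul_left, h1, mul_zero]

/-! ### Units and square roots in `ℤ_N` -/

theorem isUnit_iff_not_dvd (hk : 1 ≤ k) (a : ZMod (p ^ (2 * k))) :
    IsUnit a ↔ ¬ (p : ZMod (p ^ (2 * k))) ∣ a := by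
  have hpp : p.Prime := Fact.out
  have hk2 : 0 < 2 * k := by omega
  constructor
  · intro ha hd
    have h4 : IsUnit (p : ZMod (p ^ (2 * k))) := isUnit_of_dvd_unit hd ha
    rw [ZMod.isUnit_iff_coprime, Nat.coprime_pow_right_iff hk2, Nat.coprime_self] at h4
    exact hpp.one_lt.ne' h4
  · intro hd
    obtain ⟨n, rfl⟩ := ZMod.natCast_zmod_surjective a
    rw [ZMod.isUnit_iff_coprime, Nat.coprime_pow_right_iff hk2, Nat.coprime_comm,
      hpp.coprime_iff_not_dvd]
    exact fun h => hd (by exact_mod_cast Nat.cast_dvd_cast h)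

theorem isUnit_two_mul (hp : p ≠ 2) {a : ZMod (p ^ (2 * k))} (ha : IsUnit a) :
    IsUnit (2 * a) :=
  (IsUnit.of_mul_eq_one _ (two_mul_inv_two hp)).mul ha

theorem isUnit_of_dvd_sub (hk : 1 ≤ k) {a b : ZMod (p ^ (2 * k))} (ha : IsUnit a)
    (h : (p : ZMod (p ^ (2 * k))) ∣ b - a) : IsUnit b := by
  rw [isUnit_iff_not_dvd hk] at ha ⊢
  exact fun hb => ha ((dvd_sub_right hb).1 h)

/-- Hensel's lemma for the square root of an element congruent to `1`. -/
theorem exists_sq_eq_one_add (hp : p ≠ 2) (hk : 1 ≤ k) (z : ZMod (p ^ (2 * k))) :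
    ∃ v, v ^ 2 = 1 + p * z ∧ (p : ZMod (p ^ (2 * k))) ∣ v - 1 := by
  -- No iteration is needed: squaring maps the finite set `1 + pℤ_N` to itself and is injective
  -- there, since `v + w ≡ 2` is a unit. Hence it is surjective.
  let T := {v : ZMod (p ^ (2 * k)) // (p : ZMod (p ^ (2 * k))) ∣ v - 1}
  let f : T → T := fun v => ⟨v.1 ^ 2, by
    rw [show v.1 ^ 2 - 1 = (v.1 - 1) * (v.1 + 1) by ring]
    exact v.2.mul_right _⟩
  have hf : Function.Injective f := by
    rintro ⟨v, hv⟩ ⟨w, hw⟩ h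
    have h' : v ^ 2 = w ^ 2 := congrArg Subtype.val h
    have hu : IsUnit (v + w) := by
      refine isUnit_of_dvd_sub hk (isUnit_two_mul (k := k) hp isUnit_one) ?_
      rw [show v + w - 2 * 1 = (v - 1) + (w - 1) by ring]
      exact dvd_add hv hw
    refine Subtype.ext (sub_eq_zero.1 (hu.mul_right_eq_zero.1 ?_))
    linear_combination h'
  obtain ⟨⟨v, hv⟩, h⟩ := (Finite.injective_iff_surjective.1 hf) ⟨1 + p * z, by simp⟩
  exact ⟨v, congrArg Subtype.val h, hv⟩

theorem pow_dvd_of_red_eq_zero {a : ZMod (p ^ (2 * k))} (h : red p k a = 0) :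
    (p : ZMod (p ^ (2 * k))) ^ k ∣ a := by
  obtain ⟨n, rfl⟩ := ZMod.natCast_zmod_surjective a
  rw [map_natCast, ZMod.natCast_eq_zero_iff] at h
  exact_mod_cast Nat.cast_dvd_cast (α := ZMod (p ^ (2 * k))) h

theorem dvd_sub_of_red_eq (hk : 1 ≤ k) {a b : ZMod (p ^ (2 * k))} (h : red p k a = red p k b) :
    (p : ZMod (p ^ (2 * k))) ∣ a - b :=
  (dvd_pow_self _ (by omega)).trans
    (pow_dvd_of_red_eq_zero (by rw [map_sub, h, sub_self]))

/-! ### Values and support of states in `V_C ∩ V_+` -/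

/-- On `V_C ∩ V_+`, values are coefficients along the `ζ_x` that span it. -/
theorem apply_eq_of_mem (hp : p ≠ 2) (hk : 1 ≤ k) {D s : ZMod (p ^ (2 * k))} {C : ZMod (p ^ k)}
    {ψ : State p k} (hV : ψ ∈ spaceV p k D C) (hP : ψ ∈ spaceVPlus p k s)
    (x : Fin 2 → ZMod (p ^ (2 * k)))
    (hC : red p k (x 0) ^ 2 - red p k D * red p k (x 1) ^ 2 = -C)
    (hx : (p : ZMod (p ^ (2 * k))) ∣ x 0 - s * x 1) (hu : IsUnit (s * x 1)) :
    ψ (x 1) = (p : ℂ) ^ k * stateInner p k ψ (zeta p k x) := by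
  refine apply_eq_stateInner_zeta ψ x fun w hw => ?_
  -- Near the line, membership in `V_C` kills the coefficient: a second root `w` would give `(w +
  -- x₁)(w - x₁) ≡ 0` with `w + x₁ ≡ 2 s x₂` a unit. Away from the line, membership in `V_+` kills
  -- it.
  by_cases h1 : (p : ZMod (p ^ (2 * k))) ∣ w - s * x 1
  · refine stateInner_eq_zero_of_mem_span hV _ fun y hy => ?_
    by_contra! hcon
    obtain ⟨e0, e1⟩ := hcon
    simp only [cons_val_zero, cons_val_one] at e0 e1
    rw [Set.mem_ofPred_eq, e0, e1] at hy
    have hsum : IsUnit (w + x 0) := by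
      refine isUnit_of_dvd_sub hk (isUnit_two_mul hp hu) ?_
      rw [show w + x 0 - 2 * (s * x 1) = (w - s * x 1) + (x 0 - s * x 1) by ring]
      exact dvd_add h1 hx
    have hr := (hsum.map (red p k))
    rw [map_add] at hr
    refine hw (sub_eq_zero.1 (hr.mul_right_eq_zero.1 ?_))
    linear_combination hy - hC
  · refine stateInner_eq_zero_of_mem_span hP _ fun y hy => ?_
    by_contra! hcon
    obtain ⟨e0, e1⟩ := hcon
    simp only [cons_val_zero, cons_val_one] at e0 e1
    apply h1
    have d0 := dvd_sub_of_red_eq hk e0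
    have d1 := dvd_sub_of_red_eq hk e1
    rw [show w - s * x 1 = (y 0 - s * y 1) - (y 0 - w) + s * (y 1 - x 1) by ring]
    exact dvd_add (dvd_sub hy.1 d0) (d1.mul_left s)

/-- Each spanning `ζ_x` lives on `x₂ + p^k ℤ_N` with `p ∤ x₂`, which contains no multiple of `p`
because `k ≥ 1`. -/
theorem apply_eq_zero_of_mem (hk : 1 ≤ k) {s : ZMod (p ^ (2 * k))} {ψ : State p k}
    (hP : ψ ∈ spaceVPlus p k s) {b : ZMod (p ^ (2 * k))}
    (hb : (p : ZMod (p ^ (2 * k))) ∣ b) : ψ b = 0 := by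
  induction hP using Submodule.span_induction with
  | mem φ hm =>
    obtain ⟨x, ⟨-, hx⟩, rfl⟩ := hm
    refine zeta_apply_of_not x b ?_
    rintro ⟨t, rfl⟩
    refine hx (((dvd_add_left ?_).1 hb).mul_left s)
    exact (dvd_pow_self _ (by omega)).mul_right t
  | zero => rfl
  | add φ χ _ _ h1 h2 => rw [Pi.add_apply, h1, h2, add_zero]
  | smul c φ _ h1 => rw [Pi.smul_apply, h1, smul_zero]

/-! ### The hyperbola and the Hecke group -/

/-- The points of the hyperbola `x₁² - D x₂² = -p c` near the line `x₁ = s x₂`: each unit `b`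
is the second coordinate of one of them. -/
theorem exists_point (hp : p ≠ 2) (hk : 1 ≤ k) {D s : ZMod (p ^ (2 * k))} (hs : s ^ 2 = D)
    (hsu : IsUnit s) (c : ZMod (p ^ (2 * k))) {b : ZMod (p ^ (2 * k))} (hb : IsUnit b) :
    ∃ a, a ^ 2 - D * b ^ 2 = -(p * c) ∧ (p : ZMod (p ^ (2 * k))) ∣ a - s * b := by
  obtain ⟨u, hu⟩ := (hsu.mul hb).exists_right_inv
  -- With `u = (s b)⁻¹`, the equation `(s b v)² = D b² - p c` reads `v² = 1 - p c u²`.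
  obtain ⟨v, hv, hv1⟩ := exists_sq_eq_one_add hp hk (-(c * u ^ 2))
  refine ⟨s * b * v, ?_, ?_⟩
  · linear_combination (s * b) ^ 2 * hv + b ^ 2 * hs - p * c * (s * b * u + 1) * hu
  · rw [show s * b * v - s * b = s * b * (v - 1) by ring]
    exact hv1.mul_left _

/-- `H_D` acts transitively on the points of the hyperbola near the line `x₁ = s x₂`. -/
theorem exists_heckeSet_mulVec (hp : p ≠ 2) (hk : 1 ≤ k) {D s : ZMod (p ^ (2 * k))}
    (hs : s ^ 2 = D) (hsu : IsUnit s) {c : ZMod (p ^ (2 * k))} (x y : Fin 2 → ZMod (p ^ (2 * k)))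
    (hx : x 0 ^ 2 - D * x 1 ^ 2 = c) (hy : y 0 ^ 2 - D * y 1 ^ 2 = c)
    (hx1 : IsUnit (x 1)) (hy1 : IsUnit (y 1))
    (hxs : (p : ZMod (p ^ (2 * k))) ∣ x 0 - s * x 1)
    (hys : (p : ZMod (p ^ (2 * k))) ∣ y 0 - s * y 1) :
    ∃ g ∈ heckeSet p k D, toMat g *ᵥ x = y := by
  have hux : IsUnit (x 0 + s * x 1) := by
    refine isUnit_of_dvd_sub hk (isUnit_two_mul hp (hsu.mul hx1)) ?_
    rwa [show x 0 + s * x 1 - 2 * (s * x 1) = x 0 - s * x 1 by ring]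
  have huy : IsUnit (y 0 + s * y 1) := by
    refine isUnit_of_dvd_sub hk (isUnit_two_mul hp (hsu.mul hy1)) ?_
    rwa [show y 0 + s * y 1 - 2 * (s * y 1) = y 0 - s * y 1 by ring]
  obtain ⟨i, hi⟩ := hux.exists_right_inv
  obtain ⟨j, hj⟩ := huy.exists_right_inv
  obtain ⟨r, hr⟩ := hsu.exists_right_inv
  have h2 := two_mul_inv_two (k := k) hp
  generalize (2 : ZMod (p ^ (2 * k)))⁻¹ = h at h2
  -- The element sought scales `x₁ + s x₂` by `l` and `x₁ - s x₂` by `m = l⁻¹`; its entries solve `a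
  -- + s b = l`, `a - s b = m`, where `2` and `s` are invertible.
  obtain ⟨l, hl⟩ : ∃ l, l = (y 0 + s * y 1) * i := ⟨_, rfl⟩
  obtain ⟨m, hm⟩ : ∃ m, m = (x 0 + s * x 1) * j := ⟨_, rfl⟩
  have hlm : l * m = 1 := by
    rw [hl, hm]
    linear_combination (y 0 + s * y 1) * j * hi + hj
  obtain ⟨a, ha⟩ : ∃ a, a = h * (l + m) := ⟨_, rfl⟩
  obtain ⟨b, hb⟩ : ∃ b, b = h * r * (l - m) := ⟨_, rfl⟩
  have hp1 : a + s * b = l := by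
    rw [ha, hb]
    linear_combination h * (l - m) * hr + l * h2
  have hm1 : a - s * b = m := by
    rw [ha, hb]
    linear_combination -h * (l - m) * hr + m * h2
  have hdet : a ^ 2 - D * b ^ 2 = 1 := by
    rw [← hs, ← hlm, ← hp1, ← hm1]
    ring
  have e1 : (a + s * b) * (x 0 + s * x 1) = y 0 + s * y 1 := by
    rw [hp1, hl]
    linear_combination (y 0 + s * y 1) * hi
  -- This comes for free: `x` and `y` have the same product of the two coordinates, so scaling one
  -- by `l` forces scaling the other by `l⁻¹`.
  have e2 : (a - s * b) * (x 0 - s * x 1) = y 0 - s * y 1 := by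
    rw [hm1, hm]
    linear_combination j * (hx - hy) + (y 0 - s * y 1) * hj + j * (y 1 ^ 2 - x 1 ^ 2) * hs
  have h2s : ∀ u v : ZMod (p ^ (2 * k)), s * u = s * v → u = v :=
    fun u v huv => hsu.mul_left_cancel huv
  have hz0 : a * x 0 + b * D * x 1 = y 0 := by
    linear_combination h * (e1 + e2) - b * x 1 * hs + (y 0 - a * x 0 - b * s ^ 2 * x 1) * h2
  have hz1 : b * x 0 + a * x 1 = y 1 := by
    apply h2s
    linear_combination h * (e1 - e2) + (s * y 1 - s * (b * x 0 + a * x 1)) * h2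
  refine ⟨⟨!![a, b * D; b, a], ?_⟩, ⟨a, b, hdet, rfl⟩, ?_⟩
  · rw [det_fin_two_of]
    linear_combination hdet
  · funext n
    fin_cases n
    · simpa [toMat, mulVec, dotProduct, Fin.sum_univ_two] using hz0
    · simpa [toMat, mulVec, dotProduct, Fin.sum_univ_two] using hz1

/-! ### Constant modulus and normalization -/

theorem norm_apply_eq_norm_apply (hp : p ≠ 2) (hk : 1 ≤ k) {D s : ZMod (p ^ (2 * k))}
    (hs : s ^ 2 = D) (hsu : IsUnit s) {C : ZMod (p ^ k)} (hC : (p : ZMod (p ^ k)) ∣ C)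
    {ψ : State p k} (hV : ψ ∈ spaceV p k D C) (hP : ψ ∈ spaceVPlus p k s)
    (hψ : IsHeckeEigenfunction p k hp D ψ) (hnorm : IsNormalized p k ψ)
    {b c : ZMod (p ^ (2 * k))} (hb : IsUnit b) (hc : IsUnit c) : ‖ψ b‖ = ‖ψ c‖ := by
  obtain ⟨C', rfl⟩ := hC
  -- The congruence modulo `p^k` is lifted to an exact equation over `ℤ_N`, so that an element of
  -- `H_D` carries one point exactly to the other.
  have hlift : red p k (p * (C'.val : ZMod (p ^ (2 * k)))) = p * C' := by
    rw [map_mul, map_natCast, red_val]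
  obtain ⟨a, ha, ha'⟩ := exists_point hp hk hs hsu C'.val hb
  obtain ⟨d, hd, hd'⟩ := exists_point hp hk hs hsu C'.val hc
  obtain ⟨g, hg, hgx⟩ := exists_heckeSet_mulVec hp hk hs hsu ![a, b] ![d, c]
    (by simpa using ha) (by simpa using hd) (by simpa using hb) (by simpa using hc)
    (by simpa using ha') (by simpa using hd')
  obtain ⟨μ, hμ⟩ := hψ.2 g hg
  have key := norm_stateInner_zeta_mulVec hp g hμ hnorm ![a, b]
  have happ : ∀ a b : ZMod (p ^ (2 * k)), IsUnit b → a ^ 2 - D * b ^ 2 = -(p * C'.val) →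
      (p : ZMod (p ^ (2 * k))) ∣ a - s * b →
      ψ b = (p : ℂ) ^ k * stateInner p k ψ (zeta p k ![a, b]) := by
    intro a b hb h1 h2
    refine apply_eq_of_mem hp hk hV hP ![a, b] ?_ (by simpa using h2)
      (by simpa using hsu.mul hb)
    have h3 := congrArg (red p k) h1
    rw [map_neg, hlift, map_sub, map_mul, map_pow, map_pow] at h3
    simpa using h3
  rw [happ a b hb ha ha', happ d c hc hd hd', norm_mul, norm_mul, ← key, hgx]

/-- A normalized state that vanishes off the units and has constant modulus on the units. -/
theorem norm_apply_of_const (hk : 1 ≤ k) {ψ : State p k} (hnorm : IsNormalized p k ψ)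
    (h0 : ∀ b, (p : ZMod (p ^ (2 * k))) ∣ b → ψ b = 0)
    (hconst : ∀ b c : ZMod (p ^ (2 * k)), IsUnit b → IsUnit c → ‖ψ b‖ = ‖ψ c‖)
    {b : ZMod (p ^ (2 * k))} (hb : IsUnit b) : ‖ψ b‖ = 1 / √(1 - 1 / (p : ℝ)) := by
  classical
  have hpp : p.Prime := Fact.out
  have hp1 : (1 : ℝ) < p := by exact_mod_cast hpp.one_lt
  have hpos : (0 : ℝ) < p := by linarith
  have hsum : ∑ x, ‖ψ x‖ ^ 2 = ((p ^ (2 * k) : ℕ) : ℝ) := by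
    have hN : ((p ^ (2 * k) : ℕ) : ℂ) ≠ 0 := by
      exact_mod_cast (pow_pos hpp.pos (2 * k)).ne'
    unfold IsNormalized stateInner at hnorm
    rw [one_div, inv_mul_eq_one₀ hN] at hnorm
    simp only [Complex.mul_conj, Complex.normSq_eq_norm_sq] at hnorm
    exact_mod_cast hnorm.symm
  -- The number of units is `φ(p^{2k})`.
  have hcard : (Finset.univ.filter fun x : ZMod (p ^ (2 * k)) => IsUnit x).card =
      p ^ (2 * k - 1) * (p - 1) := by
    rw [← Nat.totient_prime_pow hpp (by omega : 0 < 2 * k), ← ZMod.card_units_eq_totient,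
      ← Finset.card_univ, ← Finset.card_image_of_injective _ Units.val_injective]
    congr 1
    ext x
    rw [Finset.mem_filter, Finset.mem_image]
    exact ⟨fun h => ⟨h.2.unit, Finset.mem_univ _, rfl⟩, fun ⟨u, _, hu⟩ => ⟨Finset.mem_univ _, u, hu⟩⟩
  have hsum2 : ∑ x, ‖ψ x‖ ^ 2 = (p ^ (2 * k - 1) * (p - 1) : ℕ) * ‖ψ b‖ ^ 2 := by
    rw [← hcard, ← nsmul_eq_mul, ← Finset.sum_const]
    symm
    rw [Finset.sum_filter]
    refine Finset.sum_congr rfl fun x _ => ?_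
    split_ifs with hx
    · rw [hconst b x hb hx]
    · rw [isUnit_iff_not_dvd hk, not_not] at hx
      rw [h0 x hx]
      simp
  rw [hsum] at hsum2
  push_cast [Nat.cast_sub hpp.one_lt.le] at hsum2
  have hpow : (p : ℝ) ^ (2 * k) = (p : ℝ) ^ (2 * k - 1) * p := by
    rw [← pow_succ]
    congr 1
    omega
  rw [hpow, mul_assoc, mul_right_inj' (pow_pos hpos _).ne'] at hsum2
  have hval : ‖ψ b‖ ^ 2 = (1 - 1 / (p : ℝ))⁻¹ := by
    have h1 : (p : ℝ) - 1 ≠ 0 := by linarith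
    rw [one_sub_div hpos.ne', inv_div, eq_div_iff h1]
    linarith
  rw [one_div, ← Real.sqrt_inv, ← hval, Real.sqrt_sq (norm_nonneg _)]

theorem isUnit_of_legendreSym_eq_one (hk : 1 ≤ k) {D : ZMod (p ^ (2 * k))}
    (hD : legendreSym p (D.val : ℤ) = 1) : IsUnit D := by
  rw [isUnit_iff_not_dvd hk]
  intro hd
  have h0 : ((D.val : ℤ) : ZMod p) = 0 := by
    have hdvd : p ∣ p ^ (2 * k) := dvd_pow_self p (by omega)
    have h1 := map_dvd (ZMod.castHom hdvd (ZMod p)) hd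
    rw [map_natCast, ZMod.natCast_self, zero_dvd_iff, ← ZMod.natCast_zmod_val D,
      map_natCast] at h1
    exact_mod_cast h1
  rw [(legendreSym.eq_zero_iff p _).2 h0] at hD
  exact zero_ne_one hD

end CatMap

theorem mainTheorem10 (p k : ℕ) [Fact p.Prime] (hp : 3 < p) (hk : 1 ≤ k)
    (D : ZMod (p ^ (2 * k))) (hD : legendreSym p (D.val : ℤ) = 1)
    (s : ZMod (p ^ (2 * k))) (hs : s ^ 2 = D)
    (C : ZMod (p ^ k)) (hC : (p : ZMod (p ^ k)) ∣ C)
    (ψ : CatMap.State p k)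
    (hψV : ψ ∈ CatMap.spaceV p k D C ⊓ CatMap.spaceVPlus p k s ∨
      ψ ∈ CatMap.spaceV p k D C ⊓ CatMap.spaceVMinus p k s)
    (hψ : CatMap.IsHeckeEigenfunction p k (by omega) D ψ)
    (hnorm : CatMap.IsNormalized p k ψ) (b : ZMod (p ^ (2 * k))) :
    (¬ (p : ZMod (p ^ (2 * k))) ∣ b → ‖ψ b‖ = 1 / Real.sqrt (1 - 1 / (p : ℝ))) ∧
      ((p : ZMod (p ^ (2 * k))) ∣ b → ψ b = 0) := by
  have hp2 : p ≠ 2 := by omega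
  have hsu : IsUnit s := by
    have h := CatMap.isUnit_of_legendreSym_eq_one hk hD
    rw [← hs] at h
    exact (isUnit_pow_iff two_ne_zero).1 h
  have main : ∀ s' : ZMod (p ^ (2 * k)), s' ^ 2 = D → IsUnit s' → ψ ∈ CatMap.spaceVPlus p k s' →
      ψ ∈ CatMap.spaceV p k D C →
      (¬ (p : ZMod (p ^ (2 * k))) ∣ b → ‖ψ b‖ = 1 / Real.sqrt (1 - 1 / (p : ℝ))) ∧
        ((p : ZMod (p ^ (2 * k))) ∣ b → ψ b = 0) := by
    intro s' hs' hsu' hP hV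
    refine ⟨fun hb => ?_, CatMap.apply_eq_zero_of_mem hk hP⟩
    refine CatMap.norm_apply_of_const hk hnorm (fun _ => CatMap.apply_eq_zero_of_mem hk hP) ?_
      ((CatMap.isUnit_iff_not_dvd hk b).2 hb)
    exact fun _ _ => CatMap.norm_apply_eq_norm_apply hp2 hk hs' hsu' hC hV hP hψ hnorm
  rcases hψV with ⟨hV, hP⟩ | ⟨hV, hP⟩
  · exact main s hs hsu hP hV
  -- `V_-` is by definition `V_+` for the other square root `-s`.
  · exact main (-s) (by rw [neg_sq, hs]) hsu.neg hP hV
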